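/- Theorem (Grushko). For a finitely generated group $G$, let the rank $\operatorname{rk}(G)$ be the smallest number of elements in a generating set of $G$. Let $G_1$ and $G_2$ be nontrivial finitely generated groups, and let $G_1 \ast G_2$ be their free product. Then $$\operatorname{rk}(G_1 \ast G_2) = \operatorname{rk}(G_1) + \operatorname{rk}(G_2).$$ -/

import Mathlib

open scoped Monoid.Coprod

/-- The free product of two finitely generated groups is finitely generated
(so that its rank `Group.rank` makes sense). -/
instance Monoid.Coprod.instGroupFG {G₁ G₂ : Type*} [Group G₁] [Group G₂]
    [Group.FG G₁] [Group.FG G₂] : Group.FG (G₁ ∗ G₂) := by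
  rw [Group.fg_def, ← Monoid.Coprod.range_inl_sup_range_inr]
  exact Subgroup.FG.sup ((Group.fg_iff_subgroup_fg _).1 inferInstance)
    ((Group.fg_iff_subgroup_fg _).1 inferInstance)

-- Stallings-style folding of labelled graphs. Start from one vertex with a loop for each generator
-- of the free product, and subdivide loops into edges labelled in the factors; each extra edge
-- brings a vertex, so edges minus vertices does not grow. The graph stays full: any two vertices
-- are joined by walks of every label. If a walk inside one factor joins distinct vertices with
-- label 1, `exists_exchange` makes it an edge at no cost, and collapsing it loses a vertex and at
-- least one edge (`exists_fold`). If there is no such walk, normal forms forbid label 1 between any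
-- distinct vertices (`eq_of_labelConn_one`), so fullness leaves one vertex. Its loops generate
-- every factor, and counting them bounds the sum of the ranks.

universe u v

/-- `LabelConn S x y g` says that in the graph with vertex set `E` and labelled edges `S`
there is a walk from `x` to `y` whose labels multiply to `g`: it is membership in the subgroupoid of
`E × E × G` generated by `S`. -/
inductive LabelConn {E G : Type*} [Group G] (S : Set (E × E × G)) : E → E → G → Prop
  | refl (x : E) : LabelConn S x x 1
  | step {x y : E} {g : G} : (x, y, g) ∈ S → LabelConn S x y g
  | symm {x y : E} {g : G} : LabelConn S x y g → LabelConn S y x g⁻¹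
  | trans {x y z : E} {g h : G} : LabelConn S x y g → LabelConn S y z h → LabelConn S x z (g * h)

/-! ### Walks in labelled graphs: gauge change and exchange -/

namespace LabelConn

variable {E F G H : Type*} [Group G] [Group H]

/-- Functoriality, for a map of vertices, a homomorphism of labels and a change of gauge. -/
theorem map_gauge {S : Set (E × E × G)} {T : Set (F × F × H)} (f : E → F) (θ : G →* H) (φ : E → H)
    (hS : ∀ x y g, (x, y, g) ∈ S → LabelConn T (f x) (f y) (φ x * θ g * (φ y)⁻¹))
    {x y : E} {g : G} (h : LabelConn S x y g) :
    LabelConn T (f x) (f y) (φ x * θ g * (φ y)⁻¹) := by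
  induction h with
  | refl x => simpa using LabelConn.refl (S := T) (f x)
  | step h => exact hS _ _ _ h
  | symm _ ih => simpa [mul_assoc] using ih.symm
  | trans _ _ ih₁ ih₂ => simpa [mul_assoc] using ih₁.trans ih₂

theorem map {S : Set (E × E × G)} {T : Set (F × F × H)} (f : E → F) (θ : G →* H)
    (hS : ∀ x y g, (x, y, g) ∈ S → LabelConn T (f x) (f y) (θ g))
    {x y : E} {g : G} (h : LabelConn S x y g) : LabelConn T (f x) (f y) (θ g) := by
  simpa using h.map_gauge (T := T) f θ (fun _ => 1) (by simpa using hS)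

theorem of_generates {S T : Set (E × E × G)} (hS : ∀ x y g, (x, y, g) ∈ S → LabelConn T x y g)
    {x y : E} {g : G} (h : LabelConn S x y g) : LabelConn T x y g :=
  h.map id (MonoidHom.id G) hS

theorem mono {S T : Set (E × E × G)} (hST : S ⊆ T) {x y : E} {g : G} (h : LabelConn S x y g) :
    LabelConn T x y g :=
  h.of_generates fun _ _ _ hs => .step (hST hs)

/-- If every edge at `e` were a loop, no walk could leave `e`. -/
theorem exists_edge {S : Set (E × E × G)} {e e' : E} {g : G} (h : LabelConn S e e' g)
    (hne : e ≠ e') :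
    ∃ s ∈ S, ∃ z k, z ≠ e ∧ (s = (e, z, k) ∨ s = (z, e, k⁻¹)) := by
  by_contra! hcon
  have key : ∀ {x y : E} {g : G}, LabelConn S x y g → (x = e ↔ y = e) := by
    intro x y g hxy
    induction hxy with
    | refl => rfl
    | @step x y g hs =>
      constructor
      · rintro rfl
        by_contra hy
        exact (hcon _ hs y g hy).1 rfl
      · rintro rfl
        by_contra hx
        exact (hcon _ hs x g⁻¹ hx).2 (by simp)
    | symm _ ih => exact ih.symm
    | trans _ _ ih₁ ih₂ => exact ih₁.trans ih₂
  exact hne ((key h).1 rfl).symm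

/-- Exchange: a groupoid element between distinct vertices can be made part of a generating set
without increasing its size. -/
theorem exists_exchange {S : Finset (E × E × G)} {e e' : E} {g : G}
    (h : LabelConn (S : Set (E × E × G)) e e' g) (hne : e ≠ e') :
    ∃ S₀ : Finset (E × E × G), S₀.card + 1 ≤ S.card ∧
      ∀ x y k, (x, y, k) ∈ S → LabelConn (insert (e, e', g) (S₀ : Set (E × E × G))) x y k := by
  classical
  induction hn : S.card using Nat.strong_induction_on generalizing S with
  | _ n ih =>
  subst hn
  obtain ⟨s, hsS, z, k, hz, hs⟩ := h.exists_edge hne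
  -- Contract `z` into `e` along `s`; the gauge `φ` gives `s` the trivial label, so it can be
  -- dropped.
  let π : E → E := fun x => if x = z then e else x
  let φ : E → G := fun x => if x = z then k else 1
  have hπz : π z = e := if_pos rfl
  have hπe : π e = e := if_neg hz.symm
  have hφz : φ z = k := if_pos rfl
  have hφe : φ e = 1 := if_neg hz.symm
  let S₁ : Finset (E × E × G) :=
    (S.erase s).image fun t => (π t.1, π t.2.1, φ t.1 * t.2.2 * (φ t.2.1)⁻¹)
  have hcard : S₁.card + 1 ≤ S.card := by
    rw [← Finset.card_erase_add_one hsS]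
    exact Nat.add_le_add_right Finset.card_image_le 1
  have hmap : ∀ x y l, (x, y, l) ∈ (S : Set (E × E × G)) →
      LabelConn (S₁ : Set (E × E × G)) (π x) (π y) (φ x * l * (φ y)⁻¹) := by
    intro x y l hl
    by_cases hls : (x, y, l) = s
    · have hrefl := LabelConn.refl (S := (S₁ : Set (E × E × G))) e
      rcases hs with hs | hs <;> rw [hs] at hls <;> simp only [Prod.mk.injEq] at hls <;>
        obtain ⟨rfl, rfl, rfl⟩ := hls <;> simpa [hπz, hπe, hφz, hφe] using hrefl
    · exact .step (Finset.mem_image.2 ⟨_, Finset.mem_erase.2 ⟨hls, hl⟩, rfl⟩)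
  have hback : ∀ R : Set (E × E × G), (∀ x y l, (x, y, l) ∈ S₁ → LabelConn R x y l) →
      LabelConn R e z k → ∀ x y l, (x, y, l) ∈ S → LabelConn R x y l := by
    intro R hR hk x y l hl
    have hc : ∀ x, LabelConn R (π x) x (φ x) := by
      intro x
      by_cases hx : x = z
      · subst hx; rwa [hπz, hφz]
      · simpa [π, φ, hx] using LabelConn.refl (S := R) x
    have h₁ := (hmap x y l hl).of_generates hR
    simpa [mul_assoc] using ((hc x).symm.trans h₁).trans (hc y)
  have hg := h.map_gauge π (MonoidHom.id G) φ hmap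
  rw [hπe, hφe, one_mul, MonoidHom.id_apply] at hg
  -- If `z = e'`, the walk contracts to a loop at `e` labelled `g * k⁻¹`, so the new edge recovers
  -- `s`. Otherwise it still joins `e` to `e'` with label `g` in a smaller graph.
  by_cases hze : z = e'
  · subst hze
    rw [hπz, hφz] at hg
    refine ⟨S₁, hcard, hback _ (fun _ _ _ hl => .step (Or.inr hl)) ?_⟩
    have h₁ := hg.mono (Set.subset_insert (e, z, g) _)
    simpa using h₁.symm.trans (.step (Set.mem_insert _ _))
  · have h₁ : π e' = e' := if_neg (Ne.symm hze)
    have h₂ : φ e' = 1 := if_neg (Ne.symm hze)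
    rw [h₁, h₂, inv_one, mul_one] at hg
    obtain ⟨S₀, hS₀, hgen⟩ := ih _ (by omega) hg rfl
    refine ⟨insert (e, z, k) S₀, ?_, hback _ ?_ (.step ?_)⟩
    · have := Finset.card_insert_le (e, z, k) S₀
      omega
    · intro x y l hl
      refine (hgen x y l hl).mono ?_
      rw [Finset.coe_insert]
      exact Set.insert_subset_insert (Set.subset_insert _ _)
    · simp

end LabelConn

/-! ### Graphs with labels in the factors of a free product -/

namespace Monoid.CoprodI

variable {ι : Type*} {G : ι → Type*} [∀ i, Group (G i)] {E : Type*}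

/-- The edges of a family of graphs with labels in the factors, with labels in the free product. -/
def labelledEdges (S : ∀ i, Finset (E × E × G i)) : Set (E × E × CoprodI G) :=
  {t | ∃ i x y, ∃ g : G i, (x, y, g) ∈ S i ∧ t = (x, y, of g)}

theorem mem_labelledEdges {S : ∀ i, Finset (E × E × G i)} {i : ι} {x y : E} {g : G i}
    (h : (x, y, g) ∈ S i) : (x, y, of g) ∈ labelledEdges S :=
  ⟨i, x, y, g, h, rfl⟩

/-- `SyllablePath S l x y` says that there is a walk from `x` to `y` spelling the syllables
of `l`, each read within the graph of its factor. -/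
def SyllablePath (S : ∀ i, Finset (E × E × G i)) : List (Σ i, G i) → E → E → Prop
  | [], x, y => x = y
  | a :: l, x, y => ∃ z, LabelConn (S a.1 : Set (E × E × G a.1)) x z a.2 ∧ SyllablePath S l z y

section Unfoldable

variable [∀ i, DecidableEq (G i)] {S : ∀ i, Finset (E × E × G i)}

/-- `rcons` drops a trivial head; `hS` makes the corresponding walk stay at its start. -/
theorem syllablePath_rcons
    (hS : ∀ i x y, LabelConn (S i : Set (E × E × G i)) x y 1 → x = y)
    {i : ι} (p : Word.Pair G i) (x y : E) :
    SyllablePath S (Word.rcons p).toList x y ↔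
      ∃ z, LabelConn (S i : Set (E × E × G i)) x z p.head ∧ SyllablePath S p.tail.toList z y := by
  by_cases hp : p.head = 1
  · simp only [Word.rcons, hp]
    exact ⟨fun h => ⟨x, .refl x, h⟩, fun ⟨z, hz, h⟩ => hS i x z hz ▸ h⟩
  · simp only [Word.rcons, dif_neg hp]
    rfl

variable [DecidableEq ι]

/-- Multiplying by a factor element changes only the head in that factor, and the given walk
translates the walks reading it. -/
theorem syllablePath_of_smul
    (hS : ∀ i x y, LabelConn (S i : Set (E × E × G i)) x y 1 → x = y)
    {i : ι} {g : G i} {x y : E} (h : LabelConn (S i : Set (E × E × G i)) x y g)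
    (w : Word G) (z : E) :
    SyllablePath S w.toList y z ↔ SyllablePath S (of g • w).toList x z := by
  conv_lhs => rw [← (Word.equivPair i).symm_apply_apply w, Word.equivPair_symm]
  rw [Word.of_smul_def, syllablePath_rcons hS, syllablePath_rcons hS]
  constructor
  · rintro ⟨u, hu, hw⟩
    exact ⟨u, h.trans hu, hw⟩
  · rintro ⟨u, hu, hw⟩
    exact ⟨u, by simpa using h.symm.trans hu, hw⟩

theorem syllablePath_smul
    (hS : ∀ i x y, LabelConn (S i : Set (E × E × G i)) x y 1 → x = y)
    {p : CoprodI G} {x y : E} (h : LabelConn (labelledEdges S) x y p) :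
    ∀ (w : Word G) (z : E),
      SyllablePath S w.toList y z ↔ SyllablePath S (p • w).toList x z := by
  induction h with
  | refl x => simp
  | step h =>
    obtain ⟨i, x, y, g, hg, heq⟩ := h
    cases heq
    exact syllablePath_of_smul hS (.step hg)
  | symm _ ih => intro w z; rw [ih, smul_inv_smul]
  | trans _ _ ih₁ ih₂ => intro w z; rw [ih₂, ih₁, mul_smul]

end Unfoldable

/-- A graph with no trivially labelled walk in a single factor between distinct vertices has
no trivially labelled walk between distinct vertices at all. -/
theorem eq_of_labelConn_one {S : ∀ i, Finset (E × E × G i)}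
    (hS : ∀ i x y, LabelConn (S i : Set (E × E × G i)) x y 1 → x = y)
    {x y : E} (h : LabelConn (labelledEdges S) x y 1) : x = y := by
  classical
  have := (syllablePath_smul hS h Word.empty y).1 rfl
  rwa [one_smul] at this

/-- A graph with one vertex that generates the free product generates every factor. -/
theorem closure_labels_eq_top [DecidableEq ι] [∀ i, DecidableEq (G i)] [Nonempty E]
    {S : ∀ i, Finset (E × E × G i)}
    (hfull : ∀ x y p, LabelConn (labelledEdges S) x y p) (i : ι) :
    Subgroup.closure (((S i).image fun t => t.2.2 : Finset (G i)) : Set (G i)) = ⊤ := by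
  rw [eq_top_iff]
  intro g _
  -- The retraction onto `G i` that kills the other factors.
  let r : CoprodI G →* G i := lift (Pi.mulSingle i (MonoidHom.id (G i)))
  have key : ∀ {x y : E} {p : CoprodI G}, LabelConn (labelledEdges S) x y p →
      r p ∈ Subgroup.closure (((S i).image fun t => t.2.2 : Finset (G i)) : Set (G i)) := by
    intro x y p h
    induction h with
    | refl => rw [map_one]; exact one_mem _
    | step h =>
      obtain ⟨j, x, y, a, ha, heq⟩ := h
      cases heq
      by_cases hij : j = i
      · subst hij
        refine Subgroup.subset_closure ?_
        simp only [r, lift_of, Pi.mulSingle_eq_same, MonoidHom.id_apply]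
        exact Finset.mem_coe.2 (Finset.mem_image_of_mem (fun t => t.2.2) ha)
      · simp only [r, lift_of, Pi.mulSingle_eq_of_ne hij, MonoidHom.one_apply]
        exact one_mem _
    | symm _ ih => rw [map_inv]; exact inv_mem ih
    | trans _ _ ih₁ ih₂ => rw [map_mul]; exact mul_mem ih₁ ih₂
  obtain ⟨x⟩ := ‹Nonempty E›
  have := key (hfull x x (of g))
  simpa [r] using this

/-! ### Folding and the edge count -/

variable [Fintype ι]

/-- Merging two vertices of a graph that are joined by a trivially labelled walk in one factor. -/
theorem exists_fold [Fintype E] {S : ∀ i, Finset (E × E × G i)}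
    (hfull : ∀ x y p, LabelConn (labelledEdges S) x y p) {i : ι} {e e' : E}
    (h : LabelConn (S i : Set (E × E × G i)) e e' 1) (hne : e ≠ e') :
    ∃ S' : ∀ i, Finset ({x // x ≠ e'} × {x // x ≠ e'} × G i),
      (∀ x y p, LabelConn (labelledEdges S') x y p) ∧
      ∑ j, (S' j).card + 1 ≤ ∑ j, (S j).card := by
  classical
  obtain ⟨S₀, hcard, hgen⟩ := h.exists_exchange hne
  let f : E → {x // x ≠ e'} := fun x => if hx : x = e' then ⟨e, hne⟩ else ⟨x, hx⟩
  have hfe : f e = ⟨e, hne⟩ := dif_neg hne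
  have hfe' : f e' = ⟨e, hne⟩ := dif_pos rfl
  have hf : ∀ x : {x // x ≠ e'}, f x = x := fun x => dif_neg x.2
  -- The exchanged edge `(e, e', 1)` is left out: `f` turns it into a trivial loop.
  let T : ∀ j, Finset (E × E × G j) := Function.update S i S₀
  let S' : ∀ j, Finset ({x // x ≠ e'} × {x // x ≠ e'} × G j) :=
    fun j => (T j).image fun t => (f t.1, f t.2.1, t.2.2)
  have hT : ∀ {j x y} {g : G j}, (x, y, g) ∈ T j →
      LabelConn (labelledEdges S') (f x) (f y) (of g) := fun hg =>
    .step (mem_labelledEdges (Finset.mem_image_of_mem (fun t => (f t.1, f t.2.1, t.2.2)) hg))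
  refine ⟨S', fun x y p => ?_, ?_⟩
  · rw [← hf x, ← hf y]
    refine (hfull x y p).map f (MonoidHom.id _) ?_
    rintro x y _ ⟨j, x, y, g, hg, heq⟩
    cases heq
    by_cases hj : j = i
    · subst hj
      refine (hgen x y g hg).map f of ?_
      rintro x y k (hk | hk)
      · cases hk
        rw [hfe, hfe', map_one]
        exact .refl _
      · exact hT (by simpa [T] using hk)
    · exact hT (by simpa [T, hj] using hg)
  · calc ∑ j, (S' j).card + 1 ≤ ∑ j, (T j).card + 1 :=
          Nat.add_le_add_right (Finset.sum_le_sum fun j _ => Finset.card_image_le) 1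
      _ ≤ ∑ j, (S j).card := by
          rw [← Finset.add_sum_erase _ _ (Finset.mem_univ i),
            ← Finset.add_sum_erase _ (fun j => (S j).card) (Finset.mem_univ i)]
          have : ∑ j ∈ Finset.univ.erase i, (T j).card = ∑ j ∈ Finset.univ.erase i, (S j).card :=
            Finset.sum_congr rfl fun j hj => by simp [T, Finset.ne_of_mem_erase hj]
          rw [this]
          simp only [T, Function.update_self]
          omega

/-- Fold until impossible, by induction on the number of vertices; each fold preserves the bound on
edges minus vertices. -/
theorem sum_rank_le_of_graph [∀ i, Group.FG (G i)] (m : ℕ) : ∀ (E : Type) [Fintype E] [Nonempty E]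
    (S : ∀ i, Finset (E × E × G i)) (n : ℕ), Fintype.card E = m →
    (∀ x y p, LabelConn (labelledEdges S) x y p) →
    ∑ i, (S i).card + 1 ≤ Fintype.card E + n → ∑ i, Group.rank (G i) ≤ n := by
  classical
  induction m with
  | zero => intro E _ _ S n hm; exact absurd hm Fintype.card_ne_zero
  | succ m ih =>
    intro E _ _ S n hm hfull hcard
    by_cases hS : ∀ i x y, LabelConn (S i : Set (E × E × G i)) x y 1 → x = y
    · have : Fintype.card E ≤ 1 :=
        Fintype.card_le_one_iff.2 fun x y => eq_of_labelConn_one hS (hfull x y 1)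
      calc ∑ i, Group.rank (G i) ≤ ∑ i, (S i).card := Finset.sum_le_sum fun i _ =>
            (Group.rank_le (closure_labels_eq_top hfull i)).trans Finset.card_image_le
        _ ≤ n := by omega
    · push Not at hS
      obtain ⟨i, e, e', h, hne⟩ := hS
      obtain ⟨S', hfull', hcard'⟩ := exists_fold hfull h hne
      have hE : Fintype.card {x // x ≠ e'} + 1 = Fintype.card E := by
        have := Fintype.card_pos_iff.2 ⟨e⟩
        rw [Fintype.card_subtype_compl, Fintype.card_subtype_eq]
        omega
      have : Nonempty {x // x ≠ e'} := ⟨⟨e, hne⟩⟩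
      exact ih {x // x ≠ e'} S' n (by omega) hfull' (by omega)

/-! ### Subdividing edges into syllables -/

section Subdivision

variable [DecidableEq ι]

omit [∀ i, Group (G i)] in
theorem sum_card_update_insert [DecidableEq E] [∀ i, DecidableEq (G i)]
    (S : ∀ i, Finset (E × E × G i)) (i : ι) (t : E × E × G i) :
    ∑ j, (Function.update S i (insert t (S i)) j).card ≤ ∑ j, (S j).card + 1 := by
  have h := Finset.card_insert_le t (S i)
  have h' : ∑ j ∈ Finset.univ.erase i, (Function.update S i (insert t (S i)) j).card =
      ∑ j ∈ Finset.univ.erase i, (S j).card :=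
    Finset.sum_congr rfl fun j hj => by rw [Function.update_of_ne (Finset.ne_of_mem_erase hj)]
  rw [← Finset.add_sum_erase _ _ (Finset.mem_univ i),
    ← Finset.add_sum_erase _ (fun j => (S j).card) (Finset.mem_univ i), h', Function.update_self]
  omega

omit [∀ i, Group (G i)] [Fintype ι] in
theorem mem_update_insert [DecidableEq E] [∀ i, DecidableEq (G i)]
    (S : ∀ i, Finset (E × E × G i)) (i : ι) (t : E × E × G i)
    {j : ι} {u : E × E × G j} (hu : u ∈ S j) : u ∈ Function.update S i (insert t (S i)) j := by
  by_cases hj : j = i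
  · subst hj; simp [hu]
  · simpa [hj] using hu

omit [DecidableEq ι] in
/-- Splitting off the first syllable of an edge, at the cost of one new vertex. -/
theorem exists_subdivision {S : ∀ i, Finset (E × E × G i)} {A : Finset (E × E × CoprodI G)}
    {i : ι} {a : G i} {q : CoprodI G} {x y : E}
    (hfull : ∀ u v p, LabelConn
      (labelledEdges S ∪ insert (x, y, of a * q) (A : Set (E × E × CoprodI G))) u v p) :
    ∃ (S' : ∀ i, Finset (Option E × Option E × G i))
      (A' : Finset (Option E × Option E × CoprodI G)),
      ∑ j, (S' j).card ≤ ∑ j, (S j).card + 1 ∧ A'.card = A.card ∧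
      ∀ u v p, LabelConn (labelledEdges S' ∪
        insert (none, some y, q) (A' : Set (Option E × Option E × CoprodI G))) u v p := by
  classical
  let S₁ : ∀ j, Finset (Option E × Option E × G j) :=
    fun j => (S j).image fun t => (some t.1, some t.2.1, t.2.2)
  let S' := Function.update S₁ i (insert (some x, none, a) (S₁ i))
  let A' : Finset (Option E × Option E × CoprodI G) :=
    A.image fun t => (some t.1, some t.2.1, t.2.2)
  let R : Set (Option E × Option E × CoprodI G) :=
    labelledEdges S' ∪ insert (none, some y, q) (A' : Set (Option E × Option E × CoprodI G))
  have hnew : LabelConn R (some x) none (of a) :=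
    .step (Or.inl (mem_labelledEdges (by simp [S'])))
  have hsome : ∀ u v p, LabelConn R (some u) (some v) p := by
    intro u v p
    refine (hfull u v p).map some (MonoidHom.id _) ?_
    rintro u v p (⟨j, u, v, g, hg, heq⟩ | huv | huv)
    · cases heq
      exact .step (Or.inl (mem_labelledEdges (mem_update_insert S₁ i _
        (Finset.mem_image_of_mem (fun t => (some t.1, some t.2.1, t.2.2)) hg))))
    · obtain ⟨rfl, rfl, rfl⟩ : u = x ∧ v = y ∧ p = of a * q := by simpa using huv
      exact hnew.trans (.step (Or.inr (Or.inl rfl)))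
    · exact .step (Or.inr (Or.inr
        (Finset.mem_image_of_mem (fun t => (some t.1, some t.2.1, t.2.2)) huv)))
  have hleft : ∀ u p, LabelConn R u (some x) p := by
    rintro (_ | u) p
    · have h := hnew.symm.trans (hsome x x (of a * p))
      rwa [inv_mul_cancel_left] at h
    · exact hsome u x p
  refine ⟨S', A', ?_, ?_, fun u v p => ?_⟩
  · exact (sum_card_update_insert S₁ i _).trans
      (Nat.add_le_add_right (Finset.sum_le_sum fun j _ => Finset.card_image_le) 1)
  · refine Finset.card_image_of_injective _ ?_
    rintro ⟨_, _, _⟩ ⟨_, _, _⟩ h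
    simpa using h
  · have h := (hleft u p).trans (hleft v 1).symm
    rwa [inv_one, mul_one] at h

end Subdivision

/-- A finite graph with `N` additional edges labelled by arbitrary elements of the free product:
such edges can be subdivided into edges with labels in the factors. -/
theorem sum_rank_le_of_mixed_graph [Nonempty ι] [∀ i, Group.FG (G i)] (N : ℕ) :
    ∀ (E : Type) [Fintype E] [Nonempty E]
    (S : ∀ i, Finset (E × E × G i)) (A : Finset (E × E × CoprodI G)) (n : ℕ), A.card = N →
    (∀ x y p, LabelConn (labelledEdges S ∪ (A : Set (E × E × CoprodI G))) x y p) →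
    ∑ i, (S i).card + A.card + 1 ≤ Fintype.card E + n → ∑ i, Group.rank (G i) ≤ n := by
  classical
  induction N with
  | zero =>
    intro E _ _ S A n hA hfull hcard
    obtain rfl := Finset.card_eq_zero.1 hA
    exact sum_rank_le_of_graph _ E S n rfl (by simpa using hfull) (by simpa using hcard)
  | succ N ih =>
    -- Inner induction on the syllables of one long edge. The 2 counts this edge, which is absent
    -- from `A`, and the original 1.
    have main : ∀ (q : CoprodI G) (E : Type) [Fintype E] [Nonempty E]
        (S : ∀ i, Finset (E × E × G i)) (A : Finset (E × E × CoprodI G)) (n : ℕ) (x y : E),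
        A.card = N →
        (∀ u v p, LabelConn (labelledEdges S ∪ insert (x, y, q) (A : Set (E × E × CoprodI G)))
          u v p) →
        ∑ i, (S i).card + A.card + 2 ≤ Fintype.card E + n → ∑ i, Group.rank (G i) ≤ n := by
      intro q
      induction q using induction_left with
      | one =>
        intro E _ _ S A n x y hA hfull hcard
        -- The remaining trivial edge may be assigned to any factor.
        obtain ⟨i⟩ := ‹Nonempty ι›
        have hsum := sum_card_update_insert S i (x, y, 1)
        refine ih E (Function.update S i (insert (x, y, 1) (S i))) A n hA
          (fun u v p => (hfull u v p).of_generates ?_) (by omega)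
        rintro u v p (⟨j, u, v, g, hg, heq⟩ | huv | huv)
        · cases heq
          exact .step (Or.inl (mem_labelledEdges (mem_update_insert S i _ hg)))
        · obtain ⟨rfl, rfl, rfl⟩ : u = x ∧ v = y ∧ p = 1 := by simpa using huv
          rw [← map_one (of (i := i))]
          exact .step (Or.inl (mem_labelledEdges (by simp)))
        · exact .step (Or.inr huv)
      | @mul i a q ihq =>
        intro E _ _ S A n x y hA hfull hcard
        obtain ⟨S', A', hS', hA', hfull'⟩ := exists_subdivision hfull
        exact ihq (Option E) S' A' n none (some y) (hA'.trans hA) hfull'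
          (by rw [Fintype.card_option]; omega)
    intro E _ _ S A n hA hfull hcard
    obtain ⟨⟨x, y, q⟩, hq⟩ := Finset.card_pos.1 (N.succ_pos.trans_eq hA.symm)
    have hA₁ := Finset.card_erase_add_one hq
    refine main q E S (A.erase (x, y, q)) n x y (by omega) ?_ (by omega)
    rwa [← Finset.coe_insert, Finset.insert_erase hq]

/-- **Grushko's theorem**, the lower bound on the rank of a free product. -/
theorem sum_rank_le_card [Nonempty ι] [∀ i, Group.FG (G i)]
    (A : Finset (CoprodI G)) (hA : Subgroup.closure (A : Set (CoprodI G)) = ⊤) :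
    ∑ i, Group.rank (G i) ≤ A.card := by
  classical
  let B : Finset (Unit × Unit × CoprodI G) := A.image fun p => ((), (), p)
  have hB : B.card = A.card := Finset.card_image_of_injective _ fun p q h => by simpa using h
  refine sum_rank_le_of_mixed_graph _ Unit (fun _ => ∅) B A.card rfl ?_ (by simp; omega)
  intro x y p
  have hp : p ∈ Subgroup.closure (A : Set (CoprodI G)) := hA ▸ Subgroup.mem_top p
  induction hp using Subgroup.closure_induction with
  | mem p hp => exact .step (Or.inr (Finset.mem_image_of_mem (fun p => ((), (), p)) hp))
  | one => exact .refl _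
  | mul _ _ _ _ h₁ h₂ => exact LabelConn.trans h₁ h₂
  | inv _ _ h => exact LabelConn.symm h

end Monoid.CoprodI

/-! ### The binary free product -/

theorem Monoid.Coprod.rank_le_add {G₁ G₂ : Type*} [Group G₁] [Group G₂]
    [Group.FG G₁] [Group.FG G₂] :
    Group.rank (G₁ ∗ G₂) ≤ Group.rank G₁ + Group.rank G₂ := by
  classical
  obtain ⟨A₁, hA₁, h₁⟩ := Group.rank_spec G₁
  obtain ⟨A₂, hA₂, h₂⟩ := Group.rank_spec G₂
  rw [← hA₁, ← hA₂]
  refine (Group.rank_le (S := A₁.image inl ∪ A₂.image inr) ?_).trans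
    ((Finset.card_union_le _ _).trans (Nat.add_le_add Finset.card_image_le Finset.card_image_le))
  rw [Finset.coe_union, Finset.coe_image, Finset.coe_image, Subgroup.closure_union,
    ← MonoidHom.map_closure, ← MonoidHom.map_closure, h₁, h₂, ← MonoidHom.range_eq_map,
    ← MonoidHom.range_eq_map, range_inl_sup_range_inr]

/-- The isomorphisms allow lifted copies of the groups, as a family over `Bool` needs a common
universe. -/
theorem Monoid.Coprod.add_rank_le_of_family {G₁ G₂ : Type*} [Group G₁] [Group G₂]
    [Group.FG G₁] [Group.FG G₂] (G : Bool → Type*) [∀ b, Group (G b)] [∀ b, Group.FG (G b)]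
    (e₁ : G₁ ≃* G false) (e₂ : G₂ ≃* G true) :
    Group.rank G₁ + Group.rank G₂ ≤ Group.rank (G₁ ∗ G₂) := by
  classical
  let f : G₁ ∗ G₂ →* CoprodI G :=
    lift (CoprodI.of.comp e₁.toMonoidHom) (CoprodI.of.comp e₂.toMonoidHom)
  have hf : Function.Surjective f := by
    intro p
    induction p using CoprodI.induction_left with
    | one => exact ⟨1, map_one f⟩
    | @mul b m p ih =>
      obtain ⟨q, rfl⟩ := ih
      cases b
      · exact ⟨inl (e₁.symm m) * q, by simp [f]⟩
      · exact ⟨inr (e₂.symm m) * q, by simp [f]⟩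
  obtain ⟨A, hA, hgen⟩ := Group.rank_spec (G₁ ∗ G₂)
  have h := CoprodI.sum_rank_le_card (G := G) (A.image f) (by
    rw [Finset.coe_image, ← MonoidHom.map_closure, hgen, ← MonoidHom.range_eq_map,
      MonoidHom.range_eq_top.2 hf])
  rw [Fintype.sum_bool, add_comm, ← Group.rank_congr e₁, ← Group.rank_congr e₂] at h
  exact (h.trans Finset.card_image_le).trans_eq hA

theorem Monoid.Coprod.add_rank_le {G₁ : Type u} {G₂ : Type v} [Group G₁] [Group G₂]
    [Group.FG G₁] [Group.FG G₂] :
    Group.rank G₁ + Group.rank G₂ ≤ Group.rank (G₁ ∗ G₂) := by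
  let e₁ := (MulEquiv.ulift.{u, v} (α := G₁)).symm
  let e₂ := (MulEquiv.ulift.{v, u} (α := G₂)).symm
  have h₁ : Group.FG (ULift.{v} G₁) := Group.fg_of_surjective (f := e₁.toMonoidHom) e₁.surjective
  have h₂ : Group.FG (ULift.{u} G₂) := Group.fg_of_surjective (f := e₂.toMonoidHom) e₂.surjective
  exact @Monoid.Coprod.add_rank_le_of_family G₁ G₂ _ _ _ _
    (fun b => Bool.rec (ULift.{v} G₁) (ULift.{u} G₂) b)
    (fun b => Bool.rec ULift.group ULift.group b)
    (by rintro (_ | _) <;> assumption) e₁ e₂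

theorem mainTheorem9 {G₁ G₂ : Type*} [Group G₁] [Group G₂]
    [Nontrivial G₁] [Nontrivial G₂] [Group.FG G₁] [Group.FG G₂] :
    Group.rank (G₁ ∗ G₂) = Group.rank G₁ + Group.rank G₂ :=
  le_antisymm Monoid.Coprod.rank_le_add Monoid.Coprod.add_rank_le
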